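/- Theorem. All rings are commutative with identity $1\neq 0$ (except that a homomorphic image may be the zero ring), and all groups are abelian, written multiplicatively. A ring $S$ is called nil-clean if every element of $S$ is of the form $n+e$ with $n$ nilpotent and $e$ idempotent; weakly nil-clean if every element of $S$ is of the form $n+e$ or $n-e$ with $n$ nilpotent and $e$ idempotent; and weakly nil-neat if every proper homomorphic image of $S$, i.e. every quotient $S/I$ by a nonzero ideal $I$, is weakly nil-clean. Write $N(S)$ for the nilradical of $S$. For a prime $p$, a group is a $p$-group if each of its elements has order a power of $p$ (the group may be infinite). Let $R$ be a ring and $G$ a group. Then the group ring $RG$ is weakly nil-neat if and only if exactly one of the following four conditions is satisfied: (1) $G$ is trivial and $R$ is weakly nil-neat. (2) $G$ is a non-trivial $2$-group and $R$ is nil-clean. (3) $G$ is a non-trivial $3$-group and $R$ is weakly nil-clean with $3\in N(R)$. (4) $G$ is cyclic of order $2$ and $R\cong\mathbb{Z}_3$, the field of three elements. Moreover, if $R$ is nil-clean (as in (2)), then $R/N(R)$ is Boolean, that is, $x^2=x$ for all $x \in R/N(R)$; and if $R$ is weakly nil-clean with $3\in N(R)$ (as in (3)), then $R/N(R)\cong\mathbb{Z}_3$.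 -/

import Mathlib

/-- A commutative ring is nil-clean if every element is the sum of a nilpotent
and an idempotent. -/
def IsNilClean (R : Type*) [CommRing R] : Prop :=
  ∀ a : R, ∃ n e : R, IsNilpotent n ∧ IsIdempotentElem e ∧ a = n + e

/-- A commutative ring is weakly nil-clean if every element is the sum or the difference
of a nilpotent and an idempotent. -/
def IsWeaklyNilClean (R : Type*) [CommRing R] : Prop :=
  ∀ a : R, ∃ n e : R, IsNilpotent n ∧ IsIdempotentElem e ∧ (a = n + e ∨ a = n - e)

/-- A commutative ring is weakly nil-neat if every proper homomorphic image of it,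
that is, every quotient by a nonzero ideal, is weakly nil-clean. (The zero ring, which
occurs as the quotient by the unit ideal, is weakly nil-clean.) -/
def IsWeaklyNilNeat (R : Type*) [CommRing R] : Prop :=
  ∀ I : Ideal R, I ≠ ⊥ → IsWeaklyNilClean (R ⧸ I)

/-! ### Nil-clean and weakly nil-clean rings. -/

section NilClean

variable {S T : Type*} [CommRing S] [CommRing T]

/-! Units of a weakly nil-clean ring are unipotent up to sign. So if `p` is nilpotent and `RG` is
weakly nil-neat, each nonzero `x` divides `u ^ p ^ m - 1` or `u ^ p ^ m + 1` for every unit `u` and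
some `m` (`exists_dvd_pow_prime_pow`); everything rests on choosing `x`.

Let `G` be non-trivial. Augmentation is a proper image, so `R` is weakly nil-clean and 6 is
nilpotent. If neither 2 nor 3 were nilpotent, reducing `R` modulo powers of 2 and of 3 would make
`G` both a 2-group and a 3-group. So some `p` in {2, 3} is nilpotent. With `u = g`, the choice `x =
g ^ 5 - 1` makes `G` torsion, and the sum of the powers of `g` gives `g ^ 2 = 1` when the order of
`g` is prime to `p`. Hence `p = 2` forces a 2-group. If `p = 3` and `G` is not a 3-group, proper
quotients of `G` and of `R` leave only order two and the field of three elements.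

Conversely, for a `p`-group with `p` nilpotent the augmentation ideal is nil, so decompositions lift
from `R`; in the exceptional case every proper quotient sends the generator to 1 or -1. -/

lemma IsNilClean.isWeaklyNilClean (h : IsNilClean S) : IsWeaklyNilClean S := fun a => by
  obtain ⟨n, e, hn, he, rfl⟩ := h a
  exact ⟨n, e, hn, he, Or.inl rfl⟩

lemma IsWeaklyNilClean.of_surjective (h : IsWeaklyNilClean S) (f : S →+* T)
    (hf : Function.Surjective f) : IsWeaklyNilClean T := fun a => by
  obtain ⟨b, rfl⟩ := hf a
  obtain ⟨n, e, hn, he, hb⟩ := h b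
  refine ⟨f n, f e, hn.map f, he.map f, ?_⟩
  rcases hb with rfl | rfl
  · exact Or.inl (map_add f n e)
  · exact Or.inr (map_sub f n e)

lemma IsWeaklyNilClean.isWeaklyNilNeat (h : IsWeaklyNilClean S) : IsWeaklyNilNeat S :=
  fun I _ => h.of_surjective (Ideal.Quotient.mk I) Ideal.Quotient.mk_surjective

/-- A surjective image of a weakly nil-neat ring along a non-injective map is weakly nil-clean. -/
lemma IsWeaklyNilNeat.isWeaklyNilClean_of_surjective (h : IsWeaklyNilNeat S) (f : S →+* T)
    (hf : Function.Surjective f) {x : S} (hx : x ≠ 0) (hfx : f x = 0) : IsWeaklyNilClean T := by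
  have hker : RingHom.ker f ≠ ⊥ := fun hb => hx (by
    have : x ∈ RingHom.ker f := hfx
    rwa [hb, Ideal.mem_bot] at this)
  exact (h _ hker).of_surjective (RingHom.kerLift f) fun t => by
    obtain ⟨s, rfl⟩ := hf t
    exact ⟨Ideal.Quotient.mk _ s, RingHom.kerLift_mk f s⟩

lemma IsWeaklyNilNeat.of_ringEquiv (h : IsWeaklyNilNeat S) (f : S ≃+* T) : IsWeaklyNilNeat T := by
  intro I hI
  obtain ⟨y, hyI, hy⟩ := Submodule.exists_mem_ne_zero_of_ne_bot hI
  refine h.isWeaklyNilClean_of_surjective ((Ideal.Quotient.mk I).comp (f : S →+* T))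
    (Ideal.Quotient.mk_surjective.comp f.surjective) (x := f.symm y) (by simpa using hy) ?_
  simpa using Ideal.Quotient.eq_zero_iff_mem.2 hyI

lemma IsIdempotentElem.eq_one_of_isUnit {e : S} (he : IsIdempotentElem e) (hu : IsUnit e) :
    e = 1 := hu.mul_left_cancel (by rw [mul_one]; exact he)

/-- A unit of a weakly nil-clean ring is, up to sign, unipotent. -/
lemma IsWeaklyNilClean.isNilpotent_sub_one_or_add_one (h : IsWeaklyNilClean S) {u : S}
    (hu : IsUnit u) : IsNilpotent (u - 1) ∨ IsNilpotent (u + 1) := by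
  obtain ⟨n, e, hn, he, hb⟩ := h u
  rcases hb with rfl | rfl
  · have h1 : IsUnit e := by
      have := hn.neg.isUnit_add_left_of_commute hu (Commute.all _ _)
      rwa [show n + e + -n = e by ring] at this
    rw [he.eq_one_of_isUnit h1]
    exact Or.inl (by simpa using hn)
  · have h1 : IsUnit e := by
      have := hn.isUnit_add_left_of_commute hu.neg (Commute.all _ _)
      rwa [show -(n - e) + n = e by ring] at this
    rw [he.eq_one_of_isUnit h1]
    exact Or.inr (by simpa using hn)

/-- A `p ^ k`-th power makes `a` congruent to 1 modulo `p`; each further `p`-th power gains a factor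
`p`, until the modulus vanishes. -/
lemma exists_pow_prime_pow_eq_one {p : ℕ} (hp : p.Prime) (hpS : IsNilpotent (p : S)) {a : S}
    (ha : IsNilpotent (a - 1)) : ∃ m, a ^ p ^ m = 1 := by
  obtain ⟨k, hk⟩ := ha
  obtain ⟨l, hl⟩ := hpS
  obtain ⟨r, hr⟩ := exists_add_pow_prime_pow_eq hp (a - 1) 1 k
  have hk' : (a - 1) ^ p ^ k = 0 := pow_eq_zero_of_le (Nat.lt_pow_self hp.one_lt).le hk
  rw [hk', sub_add_cancel] at hr
  have hd : (p : S) ∣ a ^ p ^ k - 1 := ⟨(a - 1) * r, by rw [hr]; ring⟩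
  have := dvd_sub_pow_of_dvd_sub hd l
  rw [pow_succ, hl, zero_mul, zero_dvd_iff, one_pow, sub_eq_zero, ← pow_mul, ← pow_add] at this
  exact ⟨_, this⟩

lemma IsWeaklyNilNeat.exists_dvd_pow_prime_pow (h : IsWeaklyNilNeat S) {p : ℕ} (hp : p.Prime)
    (hpS : IsNilpotent (p : S)) {u x : S} (hu : IsUnit u) (hx : x ≠ 0) :
    ∃ m, x ∣ u ^ p ^ m - 1 ∨ x ∣ u ^ p ^ m + 1 := by
  set q := Ideal.Quotient.mk (Ideal.span {x})
  have hq : ∀ y, q y = 0 ↔ x ∣ y := fun y => by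
    rw [Ideal.Quotient.eq_zero_iff_mem, Ideal.mem_span_singleton]
  have hW : IsWeaklyNilClean (S ⧸ Ideal.span {x}) := h _ (by simpa using hx)
  have hpQ : IsNilpotent (p : S ⧸ Ideal.span {x}) := by simpa using hpS.map q
  have key : ∀ a : S, IsNilpotent (q a - 1) → ∃ m, x ∣ a ^ p ^ m - 1 := fun a ha => by
    obtain ⟨m, hm⟩ := exists_pow_prime_pow_eq_one hp hpQ ha
    exact ⟨m, (hq _).1 (by simp [hm])⟩
  rcases hW.isNilpotent_sub_one_or_add_one (hu.map q) with h1 | h1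
  · obtain ⟨m, hm⟩ := key u h1
    exact ⟨m, Or.inl hm⟩
  -- For `p = 2` the two signs agree modulo nilpotents; for odd `p`, `-u` is unipotent and the sign
  -- passes through the power.
  · rcases hp.eq_two_or_odd' with rfl | hodd
    · have h2 : IsNilpotent (q u - 1) := by
        have := (Commute.all _ _).isNilpotent_sub h1 hpQ
        rwa [show q u + 1 - ((2 : ℕ) : S ⧸ Ideal.span {x}) = q u - 1 by push_cast; ring] at this
      obtain ⟨m, hm⟩ := key u h2
      exact ⟨m, Or.inl hm⟩
    · obtain ⟨m, hm⟩ := key (-u) (by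
        have := h1.neg
        rwa [show -(q u + 1) = q (-u) - 1 by rw [map_neg]; ring] at this)
      refine ⟨m, Or.inr ?_⟩
      rw [hodd.pow.neg_pow] at hm
      have := hm.neg_right
      convert this using 1
      ring

lemma IsNilClean.isIdempotentElem_quotient (h : IsNilClean S) (x : S ⧸ nilradical S) :
    IsIdempotentElem x := by
  obtain ⟨a, rfl⟩ := Ideal.Quotient.mk_surjective x
  obtain ⟨n, e, hn, he, rfl⟩ := h a
  rw [map_add, Ideal.Quotient.eq_zero_iff_mem.2 (mem_nilradical.2 hn), zero_add]
  exact he.map _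

lemma IsNilClean.isNilpotent_two (h : IsNilClean S) : IsNilpotent (2 : S) := by
  have h2 := h.isIdempotentElem_quotient (2 : S ⧸ nilradical S)
  rw [← mem_nilradical, ← Ideal.Quotient.eq_zero_iff_mem, map_ofNat]
  have : (2 : S ⧸ nilradical S) * 2 = 2 := h2
  linear_combination this

lemma IsWeaklyNilClean.isNilClean (h : IsWeaklyNilClean S) (h2 : IsNilpotent (2 : S)) :
    IsNilClean S := fun a => by
  obtain ⟨n, e, hn, he, rfl | rfl⟩ := h a
  · exact ⟨n, e, hn, he, rfl⟩
  · exact ⟨n - 2 * e, e, (Commute.all _ _).isNilpotent_sub hn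
      ((Commute.all _ _).isNilpotent_mul_right h2), he, by ring⟩

lemma IsWeaklyNilClean.exists_eq_or_eq_neg [IsReduced S] (h : IsWeaklyNilClean S) (a : S) :
    ∃ e : S, IsIdempotentElem e ∧ (a = e ∨ a = -e) := by
  obtain ⟨n, e, hn, he, ha⟩ := h a
  rw [hn.eq_zero, zero_add, zero_sub] at ha
  exact ⟨e, he, ha⟩

lemma isReduced_quotient_nilradical : IsReduced (S ⧸ nilradical S) :=
  (Ideal.isRadical_iff_quotient_reduced _).1 (Ideal.radical_isRadical _)

lemma IsWeaklyNilClean.isNilpotent_six (h : IsWeaklyNilClean S) : IsNilpotent (6 : S) := by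
  have := isReduced_quotient_nilradical (S := S)
  have hq := h.of_surjective (Ideal.Quotient.mk (nilradical S)) Ideal.Quotient.mk_surjective
  rw [← mem_nilradical, ← Ideal.Quotient.eq_zero_iff_mem, map_ofNat]
  -- Modulo the nilradical, 2 or -2 is idempotent: 4 = 2 or 4 = -2, and 6 = 0 either way.
  obtain ⟨e, he, h2⟩ := hq.exists_eq_or_eq_neg 2
  have he' : e * e = e := he
  rcases h2 with h2 | h2
  · rw [← h2] at he'
    linear_combination 3 * he'
  · rw [show e = -2 by rw [h2, neg_neg]] at he'
    linear_combination he'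

/-- A nontrivial reduced weakly nil-clean ring of characteristic three is the field `ZMod 3`. -/
lemma IsWeaklyNilClean.nonempty_ringEquiv_zmod_three [Nontrivial S] [IsReduced S]
    (h : IsWeaklyNilClean S) (h3 : (3 : S) = 0) : Nonempty (S ≃+* ZMod 3) := by
  have hid : ∀ e : S, IsIdempotentElem e → e = 0 ∨ e = 1 := fun e he => by
    have he' : e * e = e := he
    -- In characteristic three `(1 + e) ^ 2 = 1 + 3 * e = 1`, which forces `f = 1`.
    obtain ⟨f, hf, hef⟩ := h.exists_eq_or_eq_neg (1 + e)
    have hf' : f * f = f := hf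
    have hf1 : f = 1 := by
      have : (1 + e) * (1 + e) = f * f := by rcases hef with h | h <;> rw [h]; ring
      linear_combination he' + e * h3 - hf' - this
    rcases hef with h | h
    · exact Or.inl (by linear_combination h + hf1)
    · exact Or.inr (by linear_combination h - hf1 - h3)
  have : CharP S 3 := (CharP.charP_iff_prime_eq_zero Nat.prime_three).2 (by exact_mod_cast h3)
  refine ⟨(RingEquiv.ofBijective (ZMod.castHom dvd_rfl S)
    ⟨ZMod.castHom_injective S, fun a => ?_⟩).symm⟩
  obtain ⟨e, he, ha⟩ := h.exists_eq_or_eq_neg a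
  rcases hid e he with rfl | rfl <;> rcases ha with rfl | rfl
  · exact ⟨0, by simp⟩
  · exact ⟨0, by simp⟩
  · exact ⟨1, by simp⟩
  · exact ⟨-1, by simp⟩

lemma IsWeaklyNilClean.nonempty_quotient_ringEquiv_zmod_three [Nontrivial S]
    (h : IsWeaklyNilClean S) (h3 : (3 : S) ∈ nilradical S) :
    Nonempty ((S ⧸ nilradical S) ≃+* ZMod 3) := by
  have := isReduced_quotient_nilradical (S := S)
  have : Nontrivial (S ⧸ nilradical S) := Ideal.Quotient.nontrivial_iff.2 fun ht => by
    have h1 : (1 : S) ∈ nilradical S := ht ▸ Submodule.mem_top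
    exact not_isNilpotent_one (mem_nilradical.1 h1)
  refine (h.of_surjective (Ideal.Quotient.mk _)
    Ideal.Quotient.mk_surjective).nonempty_ringEquiv_zmod_three ?_
  simpa only [map_ofNat] using Ideal.Quotient.eq_zero_iff_mem.2 h3

end NilClean

/-! ### Elements of order prime to `p`. -/

section Group

variable {G : Type*} [CommGroup G]

lemma exists_coprime_orderOf_of_not_isPGroup {p : ℕ} (hp : p.Prime)
    (hfin : ∀ g : G, IsOfFinOrder g) (h : ¬ IsPGroup p G) :
    ∃ g : G, g ≠ 1 ∧ (orderOf g).Coprime p := by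
  rw [isPGroup_iff_pow_pow_eq_one] at h
  push Not at h
  obtain ⟨g, hg⟩ := h
  obtain ⟨a, m, hm, hgm⟩ := Nat.exists_eq_pow_mul_and_not_dvd (hfin g).orderOf_pos.ne' p hp.ne_one
  refine ⟨g ^ p ^ a, hg a, ?_⟩
  refine Nat.Coprime.coprime_dvd_left (k := m) (orderOf_dvd_of_pow_eq_one ?_)
    ((Nat.Prime.coprime_iff_not_dvd hp).2 hm).symm
  rw [← pow_mul, ← hgm, pow_orderOf_eq_one]

lemma eq_one_of_pow_eq_one_of_coprime {g : G} {m n : ℕ} (hmn : m.Coprime n) (hm : g ^ m = 1)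
    (hn : g ^ n = 1) : g = 1 := by
  have := orderOf_dvd_of_pow_eq_one hm
  have h2 := orderOf_dvd_of_pow_eq_one hn
  exact orderOf_eq_one_iff.1 (Nat.eq_one_of_dvd_coprimes hmn this h2)

end Group

/-! ### Augmentation and `p`-groups. -/

namespace MonoidAlgebra

variable {R G : Type*} [CommRing R] [CommGroup G]

/-- The augmentation map of a group ring. -/
noncomputable def augmentation (R G : Type*) [CommRing R] [CommGroup G] :
    MonoidAlgebra R G →ₐ[R] R := lift R R G 1

lemma augmentation_of (g : G) : augmentation R G (of R G g) = 1 := by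
  simp [augmentation]

lemma augmentation_algebraMap (r : R) : augmentation R G (algebraMap R _ r) = r :=
  (augmentation R G).commutes r

lemma augmentation_surjective : Function.Surjective (augmentation R G) :=
  fun r => ⟨algebraMap R _ r, augmentation_algebraMap r⟩

lemma mapDomainRingHom_surjective {H : Type*} [CommGroup H] (f : G →* H)
    (hf : Function.Surjective f) : Function.Surjective (mapDomainRingHom R f) := fun x => by
  induction x using MonoidAlgebra.induction_linear with
  | zero => exact ⟨0, map_zero _⟩
  | add x y hx hy =>
    obtain ⟨a, rfl⟩ := hx
    obtain ⟨b, rfl⟩ := hy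
    exact ⟨a + b, map_add _ _ _⟩
  | single h r =>
    obtain ⟨g, rfl⟩ := hf h
    exact ⟨single g r, by simp⟩

lemma of_sub_one_ne_zero [Nontrivial R] {g : G} (hg : g ≠ 1) : of R G g - 1 ≠ 0 := fun h =>
  hg (of_injective (R := R) (by rw [map_one]; exact sub_eq_zero.1 h))

lemma isUnit_of (g : G) : IsUnit (of R G g) := (Group.isUnit g).map _

/-- If `p` is nilpotent in `R` and `G` is a `p`-group, the augmentation ideal of the group ring
is nil. -/
lemma isNilpotent_sub_augmentation {p : ℕ} (hp : p.Prime) (hpR : IsNilpotent (p : R))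
    (hG : IsPGroup p G) (x : MonoidAlgebra R G) :
    IsNilpotent (x - algebraMap R _ (augmentation R G x)) := by
  induction x using MonoidAlgebra.induction_on with
  | of g =>
    obtain ⟨k, hk⟩ := isPGroup_iff_pow_pow_eq_one.1 hG g
    rw [augmentation_of, map_one]
    have hpS : IsNilpotent (p : MonoidAlgebra R G) := by
      simpa using hpR.map (algebraMap R (MonoidAlgebra R G))
    -- Modulo `p`, `(g - 1) ^ p ^ k` equals `g ^ p ^ k - 1 = 0`.
    obtain ⟨r, hr⟩ := exists_add_pow_prime_pow_eq hp (of R G g - 1) 1 k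
    rw [sub_add_cancel, ← map_pow, hk, map_one, one_pow] at hr
    have h1 : IsNilpotent ((of R G g - 1) ^ p ^ k) := by
      have h2 : (of R G g - 1) ^ p ^ k = -(p * ((of R G g - 1) * r)) := by
        linear_combination -hr
      rw [h2]
      exact ((Commute.all _ _).isNilpotent_mul_right hpS).neg
    exact (IsNilpotent.pow_iff_pos (pow_ne_zero _ hp.ne_zero)).1 h1
  | add x y hx hy =>
    have := (Commute.all _ _).isNilpotent_add hx hy
    convert this using 1
    simp only [map_add]
    ring
  | smul r x hx =>
    have := hx.smul r
    rwa [show r • (x - algebraMap R _ (augmentation R G x)) =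
      r • x - algebraMap R _ (augmentation R G (r • x)) by
        rw [map_smul, smul_sub, smul_eq_mul, map_mul, ← Algebra.smul_def]] at this

lemma isWeaklyNilClean_of_isPGroup {p : ℕ} (hp : p.Prime) (hpR : IsNilpotent (p : R))
    (hG : IsPGroup p G) (h : IsWeaklyNilClean R) : IsWeaklyNilClean (MonoidAlgebra R G) := by
  intro x
  obtain ⟨n, e, hn, he, hx⟩ := h (augmentation R G x)
  refine ⟨x - algebraMap R _ (augmentation R G x) + algebraMap R _ n, algebraMap R _ e,
    (Commute.all _ _).isNilpotent_add (isNilpotent_sub_augmentation hp hpR hG x)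
      (hn.map (algebraMap R (MonoidAlgebra R G))), he.map (algebraMap R (MonoidAlgebra R G)), ?_⟩
  rcases hx with hx | hx
  · left
    rw [hx, map_add]
    ring
  · right
    rw [hx, map_sub]
    ring

lemma isPGroup_of_isWeaklyNilClean [Nontrivial R] {p : ℕ} (hp : p.Prime)
    (hpR : IsNilpotent (p : R)) (h : IsWeaklyNilClean (MonoidAlgebra R G)) : IsPGroup p G := by
  rw [isPGroup_iff_pow_pow_eq_one]
  intro g
  have hpS : IsNilpotent (p : MonoidAlgebra R G) := by
    simpa using hpR.map (algebraMap R (MonoidAlgebra R G))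
  have h1 : IsNilpotent (of R G g - 1) := by
    rcases h.isNilpotent_sub_one_or_add_one (isUnit_of (R := R) g) with h1 | h1
    · exact h1
    -- Augmenting `g + 1` yields 2, so the sign is again immaterial.
    · have h2 : IsNilpotent (2 : R) := by
        have := h1.map (augmentation R G)
        rwa [map_add, augmentation_of, map_one, one_add_one_eq_two] at this
      have h2S : IsNilpotent (2 : MonoidAlgebra R G) := by
        simpa only [map_ofNat] using h2.map (algebraMap R (MonoidAlgebra R G))
      have := (Commute.all _ _).isNilpotent_sub h1 h2S
      rwa [show of R G g + 1 - 2 = of R G g - 1 by ring] at this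
  obtain ⟨m, hm⟩ := exists_pow_prime_pow_eq_one hp hpS h1
  refine ⟨m, of_injective (R := R) ?_⟩
  rw [map_pow, hm, map_one]

/-! ### Necessary conditions on `G` and `R`. -/

/-- If the group ring is weakly nil-neat and `p` is nilpotent modulo some nonzero nonunit of `R`,
then `G` is a `p`-group. -/
lemma isPGroup_of_isWeaklyNilNeat_of_not_isUnit {p : ℕ} (hp : p.Prime) {r : R} (hr : r ≠ 0)
    (hr' : ¬ IsUnit r) (hpR : IsNilpotent (p : R ⧸ Ideal.span {r}))
    (h : IsWeaklyNilNeat (MonoidAlgebra R G)) : IsPGroup p G := by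
  have : Nontrivial (R ⧸ Ideal.span {r}) := Ideal.Quotient.nontrivial_iff.2
    (by rwa [Ne, Ideal.span_singleton_eq_top])
  refine isPGroup_of_isWeaklyNilClean hp hpR
    (h.isWeaklyNilClean_of_surjective (mapRingHom G (Ideal.Quotient.mk (Ideal.span {r})))
      (map_surjective _ Ideal.Quotient.mk_surjective) (x := single 1 r) (by simpa using hr) ?_)
  rw [mapRingHom_single, Ideal.Quotient.eq_zero_iff_mem.2 (Ideal.mem_span_singleton_self r),
    single_zero]

/-- The exponent 5 is a prime different from 2 and `p`. Both signs give `g ^ 5 - 1 ∣ g ^ (2 * p ^ m)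
- 1`; passing to the quotient of `G` by the powers of `g ^ 5` puts `g ^ (2 * p ^ m)` among them, and
infinite order would give `5 ∣ 2 * p ^ m`. -/
lemma isOfFinOrder_of_isWeaklyNilNeat [Nontrivial R] {p : ℕ} (hp : p.Prime) (hp5 : p ≠ 5)
    (hpR : IsNilpotent (p : R)) (h : IsWeaklyNilNeat (MonoidAlgebra R G)) (g : G) :
    IsOfFinOrder g := by
  by_cases hg : g ^ 5 = 1
  · exact isOfFinOrder_iff_pow_eq_one.2 ⟨5, by norm_num, hg⟩
  by_contra hinf
  have hpS : IsNilpotent (p : MonoidAlgebra R G) := by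
    simpa using hpR.map (algebraMap R (MonoidAlgebra R G))
  obtain ⟨m, hm⟩ := h.exists_dvd_pow_prime_pow hp hpS (isUnit_of g)
    (of_sub_one_ne_zero (R := R) hg)
  have hd : of R G (g ^ 5) - 1 ∣ of R G (g ^ (2 * p ^ m)) - 1 := by
    rw [mul_comm 2, pow_mul, map_pow (of R G) (g ^ p ^ m), map_pow (of R G) g (p ^ m)]
    rw [show ((of R G g) ^ p ^ m) ^ 2 - 1 = (of R G g ^ p ^ m - 1) * (of R G g ^ p ^ m + 1) by ring]
    rcases hm with hm | hm
    · exact hm.mul_right _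
    · exact hm.mul_left _
  let f := mapDomainRingHom R (QuotientGroup.mk' (Subgroup.zpowers (g ^ 5)))
  have hf : ∀ a : G, f (of R G a) = of R _ (QuotientGroup.mk' (Subgroup.zpowers (g ^ 5)) a) :=
    fun a => by simp [f]
  have hmem : g ^ (2 * p ^ m) ∈ Subgroup.zpowers (g ^ 5) := by
    have h1 := map_dvd f hd
    rw [map_sub, map_sub, hf, hf, map_one,
      QuotientGroup.mk'_apply, QuotientGroup.mk'_apply,
      (QuotientGroup.eq_one_iff (N := Subgroup.zpowers (g ^ 5)) (g ^ 5)).2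
        (Subgroup.mem_zpowers _), map_one, sub_self, zero_dvd_iff] at h1
    by_contra hn
    exact of_sub_one_ne_zero (fun h2 => hn ((QuotientGroup.eq_one_iff _).1 h2)) h1
  obtain ⟨j, hj⟩ := Subgroup.mem_zpowers_iff.1 hmem
  have hinj := injective_zpow_iff_not_isOfFinOrder.2 hinf
  have hj' : (5 : ℤ) * j = ((2 * p ^ m : ℕ) : ℤ) := hinj (by
    simp only [zpow_mul, zpow_natCast]
    exact_mod_cast hj)
  have h5 : 5 ∣ 2 * p ^ m := by
    have : (5 : ℤ) ∣ ((2 * p ^ m : ℕ) : ℤ) := ⟨j, hj'.symm⟩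
    exact_mod_cast this
  rcases (Nat.Prime.dvd_mul Nat.prime_five).1 h5 with h5 | h5
  · revert h5
    decide
  · exact hp5 ((Nat.prime_dvd_prime_iff_eq Nat.prime_five hp).1
      (Nat.prime_five.dvd_of_dvd_pow h5)).symm

lemma sum_range_orderOf_ne_zero [Nontrivial R] {g : G} (hg : IsOfFinOrder g) :
    ∑ i ∈ Finset.range (orderOf g), of R G g ^ i ≠ 0 := by
  classical
  intro h
  have h1 := congrArg (fun x : MonoidAlgebra R G => x.coeff 1) h
  have h2 : ∀ i ∈ Finset.range (orderOf g), (of R G g ^ i).coeff 1 = if i = 0 then 1 else 0 := by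
    intro i hi
    rw [← map_pow, of_apply, coeff_single, Finsupp.single_apply]
    congr 1
    rw [← orderOf_dvd_iff_pow_eq_one]
    refine propext ⟨fun hd => Nat.eq_zero_of_dvd_of_lt hd (Finset.mem_range.1 hi), ?_⟩
    rintro rfl
    exact dvd_zero _
  simp only [coeff_sum, Finsupp.finsetSum_apply] at h1
  rw [Finset.sum_congr rfl h2] at h1
  simp [hg] at h1

lemma sq_eq_one_of_mul_eq_zero [Nontrivial R] {h s : G} (hh : h ≠ 1) (hs : s ≠ 1)
    (H : (of R G h - 1) * (of R G s - 1) = 0 ∨ (of R G h - 1) * (of R G s + 1) = 0) :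
    h ^ 2 = 1 := by
  classical
  have hexp : ∀ g : G, (single (h * s) (1 : R) : MonoidAlgebra R G).coeff g
      = (single h (1 : R)).coeff g + (single s (1 : R)).coeff g - (single 1 (1 : R)).coeff g ∨
      (single (h * s) (1 : R) : MonoidAlgebra R G).coeff g
      = (single s (1 : R)).coeff g - (single h (1 : R)).coeff g + (single 1 (1 : R)).coeff g := by
    intro g
    have hm : of R G h * of R G s = single (h * s) 1 := by rw [← map_mul]; rfl
    have h1 : of R G h = single h 1 := rfl
    have h2 : of R G s = single s 1 := rfl
    rcases H with H | H
    · left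
      have : single (h * s) (1 : R) = single h 1 + single s 1 - single 1 (1 : R) := by
        rw [← hm, ← h1, ← h2, ← one_def]
        linear_combination H
      rw [this]
      simp
    · right
      have : single (h * s) (1 : R) = single s 1 - single h 1 + single 1 (1 : R) := by
        rw [← hm, ← h1, ← h2, ← one_def]
        linear_combination H
      rw [this]
      simp
  -- Compare coefficients at 1, then at `h`: in each case a mismatch would give 1 = 0 in `R`.
  have hhs : h * s = 1 := by
    by_contra hne
    have := hexp 1
    simp [hne, hh, hs] at this
  have h2 : s = h := by
    by_contra hne
    have := hexp h
    simp [hhs, hne, hh.symm] at this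
  rw [sq]
  rwa [h2] at hhs

lemma sq_eq_one_of_isWeaklyNilNeat [Nontrivial R] {p : ℕ} (hp : p.Prime)
    (hpR : IsNilpotent (p : R)) (h : IsWeaklyNilNeat (MonoidAlgebra R G)) {g : G}
    (hfin : IsOfFinOrder g) (hg : (orderOf g).Coprime p) : g ^ 2 = 1 := by
  by_cases hg1 : g = 1
  · rw [hg1, one_pow]
  have hpS : IsNilpotent (p : MonoidAlgebra R G) := by
    simpa using hpR.map (algebraMap R (MonoidAlgebra R G))
  obtain ⟨m, hm⟩ := h.exists_dvd_pow_prime_pow hp hpS (isUnit_of g)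
    (sum_range_orderOf_ne_zero (R := R) hfin)
  -- `g - 1` kills the sum of powers, hence every multiple of it.
  have h0 : (of R G g - 1) * ∑ i ∈ Finset.range (orderOf g), of R G g ^ i = 0 := by
    rw [mul_geom_sum, ← map_pow, pow_orderOf_eq_one, map_one, sub_self]
  have key : ∀ y, ∑ i ∈ Finset.range (orderOf g), of R G g ^ i ∣ y → (of R G g - 1) * y = 0 := by
    rintro y ⟨z, rfl⟩
    rw [← mul_assoc, h0, zero_mul]
  refine sq_eq_one_of_mul_eq_zero (R := R) (s := g ^ p ^ m) hg1 (fun hs => hg1 ?_) ?_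
  · exact eq_one_of_pow_eq_one_of_coprime (hg.pow_right m) (pow_orderOf_eq_one g) hs
  · rw [map_pow]
    exact hm.imp (key _) (key _)

lemma isPGroup_two_of_isWeaklyNilNeat [Nontrivial R] (h2 : IsNilpotent (2 : R))
    (h : IsWeaklyNilNeat (MonoidAlgebra R G)) : IsPGroup 2 G := by
  have h2' : IsNilpotent ((2 : ℕ) : R) := by exact_mod_cast h2
  have hfin := isOfFinOrder_of_isWeaklyNilNeat Nat.prime_two (by norm_num) h2' h
  by_contra hG
  obtain ⟨g, hg1, hg⟩ := exists_coprime_orderOf_of_not_isPGroup Nat.prime_two hfin hG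
  exact hg1 (eq_one_of_pow_eq_one_of_coprime hg (pow_orderOf_eq_one g)
    (sq_eq_one_of_isWeaklyNilNeat Nat.prime_two h2' h (hfin g) hg))

lemma card_eq_two_and_ringEquiv_of_isWeaklyNilNeat [Nontrivial R] (hR : IsWeaklyNilClean R)
    (h3 : IsNilpotent (3 : R)) (h : IsWeaklyNilNeat (MonoidAlgebra R G)) (hG : ¬ IsPGroup 3 G) :
    Nat.card G = 2 ∧ Nonempty (R ≃+* ZMod 3) := by
  have h3' : IsNilpotent ((3 : ℕ) : R) := by exact_mod_cast h3
  have hfin := isOfFinOrder_of_isWeaklyNilNeat Nat.prime_three (by norm_num) h3' h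
  constructor
  · obtain ⟨k, hk1, hk⟩ := exists_coprime_orderOf_of_not_isPGroup Nat.prime_three hfin hG
    have hk2 := sq_eq_one_of_isWeaklyNilNeat Nat.prime_three h3' h (hfin k) hk
    have hk3 : ∀ a, k ^ 3 ^ a ≠ 1 := fun a ha => hk1
      (eq_one_of_pow_eq_one_of_coprime (Nat.Coprime.pow_right a (by norm_num)) hk2 ha)
    -- Quotients of `G` by non-trivial cyclic subgroups are 3-groups, so the involution `k` dies in
    -- each.
    have hmem : ∀ g : G, g ≠ 1 → k ∈ Subgroup.zpowers g := fun g hg => by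
      have hW := h.isWeaklyNilClean_of_surjective
        (mapDomainRingHom R (QuotientGroup.mk' (Subgroup.zpowers g)))
        (mapDomainRingHom_surjective _ (QuotientGroup.mk'_surjective _))
        (of_sub_one_ne_zero (R := R) hg) (by
          rw [map_sub, map_one, sub_eq_zero, of_apply, mapDomainRingHom_apply, mapDomain_single,
            QuotientGroup.mk'_apply, (QuotientGroup.eq_one_iff g).2 (Subgroup.mem_zpowers g),
            one_def])
      obtain ⟨a, ha⟩ := isPGroup_iff_pow_pow_eq_one.1
        (isPGroup_of_isWeaklyNilClean Nat.prime_three h3' hW) (k : G ⧸ Subgroup.zpowers g)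
      rw [← QuotientGroup.eq_one_iff]
      exact eq_one_of_pow_eq_one_of_coprime (m := 2) (Nat.Coprime.pow_right a (by norm_num))
        (by rw [← QuotientGroup.mk_pow, hk2, QuotientGroup.mk_one]) ha
    have hthree : ∀ (g : G) (a : ℕ), g ^ 3 ^ a = 1 → g = 1 := fun g a hga => by
      by_contra hg
      obtain ⟨j, rfl⟩ := Subgroup.mem_zpowers_iff.1 (hmem g hg)
      refine hk3 a ?_
      rw [← zpow_natCast, ← zpow_mul, mul_comm, zpow_mul, zpow_natCast, hga, one_zpow]
    have hsq : ∀ g : G, g ^ 2 = 1 := fun g => by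
      obtain ⟨a, m, hm, hgm⟩ := Nat.exists_eq_pow_mul_and_not_dvd (hfin g).orderOf_pos.ne' 3
        (by norm_num)
      have hgm1 : g ^ m = 1 := hthree _ a (by
        rw [← pow_mul, mul_comm, ← hgm, pow_orderOf_eq_one])
      exact sq_eq_one_of_isWeaklyNilNeat Nat.prime_three h3' h (hfin g)
        (Nat.Coprime.coprime_dvd_left (orderOf_dvd_of_pow_eq_one hgm1)
          ((Nat.Prime.coprime_iff_not_dvd Nat.prime_three).2 hm).symm)
    refine Nat.card_eq_two_iff.2 ⟨1, k, hk1.symm, Set.eq_univ_of_forall fun g => ?_⟩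
    by_cases hg : g = 1
    · exact Or.inl hg
    obtain ⟨j, hj⟩ := Subgroup.mem_zpowers_iff.1 (hmem g hg)
    have hg2 : g ^ (2 : ℤ) = 1 := by exact_mod_cast hsq g
    rcases Int.even_or_odd' j with ⟨i, rfl | rfl⟩
    · rw [zpow_mul, hg2, one_zpow] at hj
      exact absurd hj.symm hk1
    · rw [zpow_add, zpow_mul, hg2, one_zpow, one_mul, zpow_one] at hj
      exact Or.inr hj
  -- A nonzero nonunit would make `G` a 3-group, so `R` is a field.
  · have hunit : ∀ r : R, r ≠ 0 → IsUnit r := fun r hr => by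
      by_contra hu
      refine hG (isPGroup_of_isWeaklyNilNeat_of_not_isUnit Nat.prime_three hr hu ?_ h)
      simpa only [map_ofNat, Nat.cast_ofNat] using h3.map (Ideal.Quotient.mk (Ideal.span {r}))
    have : IsReduced R := ⟨fun r hr => by
      by_contra h0
      obtain ⟨n, hn⟩ := hr
      exact not_isUnit_zero (hn ▸ (hunit r h0).pow n)⟩
    exact hR.nonempty_ringEquiv_zmod_three h3.eq_zero

lemma isNilpotent_two_or_three [Nontrivial G] (hR : IsWeaklyNilClean R)
    (h : IsWeaklyNilNeat (MonoidAlgebra R G)) : IsNilpotent (2 : R) ∨ IsNilpotent (3 : R) := by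
  by_contra! hne
  obtain ⟨h2, h3⟩ := hne
  obtain ⟨k, hk⟩ := hR.isNilpotent_six
  have h23 : (2 : R) ^ k * 3 ^ k = 0 := by rw [← mul_pow, ← hk]; norm_num
  have hnil : ∀ n : ℕ, (n : R ⧸ Ideal.span {(n : R) ^ k}) ^ k = 0 := fun n => by
    rw [← map_natCast (Ideal.Quotient.mk (Ideal.span {(n : R) ^ k})), ← map_pow]
    exact Ideal.Quotient.eq_zero_iff_mem.2 (Ideal.mem_span_singleton_self _)
  -- The nonzero elements `2 ^ k` and `3 ^ k` have product zero, so neither is a unit.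
  have h2k : (2 : R) ^ k ≠ 0 := fun h0 => h2 ⟨k, h0⟩
  have h3k : (3 : R) ^ k ≠ 0 := fun h0 => h3 ⟨k, h0⟩
  have hG2 : IsPGroup 2 G := isPGroup_of_isWeaklyNilNeat_of_not_isUnit Nat.prime_two h2k
    (fun hu => h3k (hu.mul_left_cancel (by rw [h23, mul_zero])))
    ⟨k, hnil 2⟩ h
  have hG3 : IsPGroup 3 G := isPGroup_of_isWeaklyNilNeat_of_not_isUnit Nat.prime_three h3k
    (fun hu => h2k (hu.mul_right_cancel (by rw [h23, zero_mul])))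
    ⟨k, hnil 3⟩ h
  obtain ⟨g, hg⟩ := exists_ne (1 : G)
  obtain ⟨a, ha⟩ := isPGroup_iff_pow_pow_eq_one.1 hG2 g
  obtain ⟨b, hb⟩ := isPGroup_iff_pow_pow_eq_one.1 hG3 g
  exact hg (eq_one_of_pow_eq_one_of_coprime (Nat.Coprime.pow a b (by norm_num)) ha hb)

/-! ### The exceptional case. -/

/-- Every proper quotient of the group ring of the group of order two over the field of three
elements is weakly nil-clean. -/
lemma isWeaklyNilNeat_of_card_eq_two (hG : Nat.card G = 2) (e : R ≃+* ZMod 3) :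
    IsWeaklyNilNeat (MonoidAlgebra R G) := by
  have hR : ∀ r : R, r = 0 ∨ r = 1 ∨ r = -1 := fun r => by
    have : ∀ z : ZMod 3, z = 0 ∨ z = 1 ∨ z = -1 := by decide
    refine (this (e r)).imp (fun h => ?_) (Or.imp (fun h => ?_) (fun h => ?_)) <;>
      exact e.injective (by simp [h])
  obtain ⟨g, hg1, hg⟩ := (Nat.card_eq_two_iff' (1 : G)).1 hG
  have hgg : g * g = 1 := by
    by_contra hne
    have := hg _ hne
    exact hg1 (by simpa using this)
  have hspan : ∀ x : MonoidAlgebra R G,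
      ∃ a b : R, x = algebraMap R _ a + algebraMap R _ b * of R G g := fun x => by
    induction x using MonoidAlgebra.induction_linear with
    | zero => exact ⟨0, 0, by simp⟩
    | add x y hx hy =>
      obtain ⟨a, b, rfl⟩ := hx
      obtain ⟨c, d, rfl⟩ := hy
      exact ⟨a + c, b + d, by simp only [map_add]; ring⟩
    | single k r =>
      by_cases hk : k = 1
      · exact ⟨r, 0, by simp [hk]⟩
      · exact ⟨0, r, by simp [hg k hk]⟩
  intro I hI
  obtain ⟨x, hxI, hx⟩ := Submodule.exists_mem_ne_zero_of_ne_bot hI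
  set q := Ideal.Quotient.mk I
  have hu2 : q (of R G g) * q (of R G g) = 1 := by rw [← map_mul, ← map_mul, hgg, map_one, map_one]
  have hu : q (of R G g) = 1 ∨ q (of R G g) = -1 := by
    obtain ⟨a, b, rfl⟩ := hspan x
    have h0 := Ideal.Quotient.eq_zero_iff_mem.2 hxI
    generalize hu : Ideal.Quotient.mk I (of R G g) = u at *
    rw [map_add, map_mul, hu] at h0
    -- The relation `a + b * u = 0` gives `u = 1` or `u = -1` when `a` and `b` are nonzero; if
    -- exactly one of them is zero, the quotient is the zero ring.
    rcases hR a with rfl | rfl | rfl <;> rcases hR b with rfl | rfl | rfl <;>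
      simp only [map_zero, map_one, map_neg, zero_mul, add_zero, zero_add, one_mul, neg_mul] at h0 hx
    · exact absurd rfl hx
    · exact Or.inl (by linear_combination (1 - u) * h0 + hu2)
    · exact Or.inl (by linear_combination (u - 1) * h0 + hu2)
    · exact Or.inl (by linear_combination (u - 1) * h0)
    · exact Or.inr (by linear_combination h0)
    · exact Or.inl (by linear_combination -h0)
    · exact Or.inl (by linear_combination (1 - u) * h0)
    · exact Or.inl (by linear_combination h0)
    · exact Or.inr (by linear_combination -h0)
  have hS : ∀ y : MonoidAlgebra R G ⧸ I, y = 0 ∨ y = 1 ∨ y = -1 := fun y => by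
    obtain ⟨x, rfl⟩ := Ideal.Quotient.mk_surjective y
    obtain ⟨a, b, rfl⟩ := hspan x
    have hr : ∃ r : R, q (algebraMap R _ a + algebraMap R _ b * of R G g) = q (algebraMap R _ r) := by
      rcases hu with hu | hu
      · exact ⟨a + b, by simp only [map_add, map_mul, hu, mul_one]⟩
      · exact ⟨a - b, by simp only [map_add, map_sub, map_mul, hu]; ring⟩
    obtain ⟨r, hr⟩ := hr
    rw [hr]
    rcases hR r with rfl | rfl | rfl <;> simp only [map_zero, map_one, map_neg, true_or, or_true]
  intro y
  rcases hS y with rfl | rfl | rfl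
  · exact ⟨0, 0, IsNilpotent.zero, IsIdempotentElem.zero, by simp⟩
  · exact ⟨0, 1, IsNilpotent.zero, IsIdempotentElem.one, by simp⟩
  · exact ⟨0, 1, IsNilpotent.zero, IsIdempotentElem.one, by simp⟩

end MonoidAlgebra

/-! ### Exclusivity of the four conditions and assembly. -/

lemma existsUnique_fin_four {A B C D : Prop} (hAB : A → ¬ B) (hAC : A → ¬ C) (hAD : A → ¬ D)
    (hBC : B → ¬ C) (hBD : B → ¬ D) (hCD : C → ¬ D) :
    (∃! i : Fin 4, (![A, B, C, D] : Fin 4 → Prop) i) ↔ A ∨ B ∨ C ∨ D := by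
  constructor
  · rintro ⟨i, hi, -⟩
    fin_cases i
    · exact Or.inl hi
    · exact Or.inr (Or.inl hi)
    · exact Or.inr (Or.inr (Or.inl hi))
    · exact Or.inr (Or.inr (Or.inr hi))
  · have key : ∀ i : Fin 4, (![A, B, C, D] : Fin 4 → Prop) i →
        (∀ j : Fin 4, (![A, B, C, D] : Fin 4 → Prop) j → j ≠ i → False) →
        ∃! i : Fin 4, (![A, B, C, D] : Fin 4 → Prop) i := fun i hi hu =>
      ⟨i, hi, fun j hj => by_contra (hu j hj)⟩
    rintro (h | h | h | h)
    · refine key 0 h fun j hj hne => ?_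
      fin_cases j
      exacts [hne rfl, hAB h hj, hAC h hj, hAD h hj]
    · refine key 1 h fun j hj hne => ?_
      fin_cases j
      exacts [hAB hj h, hne rfl, hBC h hj, hBD h hj]
    · refine key 2 h fun j hj hne => ?_
      fin_cases j
      exacts [hAC hj h, hBC hj h, hne rfl, hCD h hj]
    · refine key 3 h fun j hj hne => ?_
      fin_cases j
      exacts [hAD hj h, hBD hj h, hCD hj h, hne rfl]

theorem mainTheorem1 {R : Type*} {G : Type*} [CommRing R] [Nontrivial R] [CommGroup G] :
    (IsWeaklyNilNeat (MonoidAlgebra R G) ↔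
      ∃! i : Fin 4,
        (![Subsingleton G ∧ IsWeaklyNilNeat R,
           Nontrivial G ∧ IsPGroup 2 G ∧ IsNilClean R,
           Nontrivial G ∧ IsPGroup 3 G ∧ IsWeaklyNilClean R ∧ (3 : R) ∈ nilradical R,
           IsCyclic G ∧ Nat.card G = 2 ∧ Nonempty (R ≃+* ZMod 3)] : Fin 4 → Prop) i) ∧
    (IsNilClean R → ∀ x : R ⧸ nilradical R, IsIdempotentElem x) ∧
    (IsWeaklyNilClean R → (3 : R) ∈ nilradical R →
      Nonempty ((R ⧸ nilradical R) ≃+* ZMod 3)) := by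
  refine ⟨?_, fun h => h.isIdempotentElem_quotient,
    fun h => h.nonempty_quotient_ringEquiv_zmod_three⟩
  have hnt : Nat.card G = 2 → Nontrivial G := fun h => by
    have : Finite G := Nat.finite_of_card_ne_zero (by omega)
    exact Finite.one_lt_card_iff_nontrivial.1 (by omega)
  have hcop : IsPGroup 2 G → IsPGroup 3 G → Subsingleton G := fun h2 h3 =>
    ⟨fun x y => by
      have : ∀ g : G, g = 1 := fun g => by
        obtain ⟨a, ha⟩ := isPGroup_iff_pow_pow_eq_one.1 h2 g
        obtain ⟨b, hb⟩ := isPGroup_iff_pow_pow_eq_one.1 h3 g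
        exact eq_one_of_pow_eq_one_of_coprime (Nat.Coprime.pow a b (by norm_num)) ha hb
      rw [this x, this y]⟩
  rw [existsUnique_fin_four]
  rotate_left
  · rintro ⟨h, -⟩ ⟨h', -⟩
    exact not_subsingleton G h
  · rintro ⟨h, -⟩ ⟨h', -⟩
    exact not_subsingleton G h
  · rintro ⟨h, -⟩ ⟨-, h', -⟩
    have := hnt h'
    exact not_subsingleton G h
  · rintro ⟨h, h2, -⟩ ⟨-, h3, -⟩
    exact not_subsingleton G (hcop h2 h3)
  · rintro ⟨-, -, h⟩ ⟨-, -, ⟨e⟩⟩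
    have h2 : IsNilpotent (2 : ZMod 3) := by
      simpa only [map_ofNat] using h.isNilpotent_two.map e
    exact absurd h2.eq_zero (by decide)
  · rintro ⟨h, h3, -⟩ ⟨-, h2, -⟩
    exact not_subsingleton G (hcop (IsPGroup.of_card (n := 1) (by simpa using h2)) h3)
  constructor
  · intro h
    rcases subsingleton_or_nontrivial G with hG | hG
    · exact Or.inl ⟨hG, h.of_ringEquiv (MonoidAlgebra.uniqueRingEquiv G)⟩
    right
    obtain ⟨g, hg⟩ := exists_ne (1 : G)
    have hR : IsWeaklyNilClean R := h.isWeaklyNilClean_of_surjective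
      (MonoidAlgebra.augmentation R G : MonoidAlgebra R G →+* R)
      MonoidAlgebra.augmentation_surjective (MonoidAlgebra.of_sub_one_ne_zero hg)
      (by rw [map_sub, map_one, RingHom.coe_coe, MonoidAlgebra.augmentation_of, sub_self])
    rcases MonoidAlgebra.isNilpotent_two_or_three hR h with h2 | h3
    · exact Or.inl ⟨hG, MonoidAlgebra.isPGroup_two_of_isWeaklyNilNeat h2 h, hR.isNilClean h2⟩
    right
    by_cases hG3 : IsPGroup 3 G
    · exact Or.inl ⟨hG, hG3, hR, mem_nilradical.2 h3⟩
    · obtain ⟨hc, he⟩ :=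
        MonoidAlgebra.card_eq_two_and_ringEquiv_of_isWeaklyNilNeat hR h3 h hG3
      have : Fact (Nat.Prime 2) := ⟨Nat.prime_two⟩
      exact Or.inr ⟨isCyclic_of_prime_card hc, hc, he⟩
  · rintro (⟨hG, h⟩ | ⟨-, hG, h⟩ | ⟨-, hG, h, h3⟩ | ⟨-, hc, ⟨e⟩⟩)
    · exact h.of_ringEquiv (MonoidAlgebra.uniqueRingEquiv G).symm
    · exact (MonoidAlgebra.isWeaklyNilClean_of_isPGroup Nat.prime_two
        (by exact_mod_cast h.isNilpotent_two) hG h.isWeaklyNilClean).isWeaklyNilNeat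
    · exact (MonoidAlgebra.isWeaklyNilClean_of_isPGroup Nat.prime_three
        (by exact_mod_cast mem_nilradical.1 h3) hG h).isWeaklyNilNeat
    · exact MonoidAlgebra.isWeaklyNilNeat_of_card_eq_two hc e
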